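/- Let $n\ge 2$, let $X=\{1,\dots,n\}$, let $S$ be the set of proper nonempty subsets of $X$, and put $\sigma(A)=X\setminus A$ for $A\in S$. The degenerate triangle presentation of type $\tilde A_{n-1}$ is $\mathcal T=T_1\cup T_2\subseteq S\times S\times S$, where $$T_1=\{(A,B,C)\mid A,B,C \text{ pairwise disjoint},\ A\cup B\cup C=X\},\qquad T_2=\{(A,B,C)\mid (\sigma(C),\sigma(B),\sigma(A))\in T_1\}.$$ Let $\Gamma_{\mathcal T}$ be the group with generators $g_A$ $(A\in S)$ and defining relations $g_Ag_Bg_C=1$ for $(A,B,C)\in\mathcal T$ and $g_Ag_{\sigma(A)}=1$ for $A\in S$. Its Cayley graph with respect to the generators $g_A$ has vertex set $\Gamma_{\mathcal T}$, and $u,v$ are joined by an edge if and only if $v=ug_A$ for some $A\in S$. Let $(W,\{s_1,\dots,s_n\})$ be a Coxeter system of type $\tilde A_{n-1}$ (its Coxeter diagram is a cycle with $n$ nodes if $n\ge 3$, and two nodes joined by an edge marked $\infty$ if $n=2$), and let $\Sigma$ be its Coxeter complex, that is, the poset of special cosets $w\langle J\rangle$ ($w\in W$, $J\subseteq\{s_1,\dots,s_n\}$)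 under the opposite of inclusion. It is a simplicial complex, regarded as the poset of its simplices, with the empty simplex included. Then the elements $g_A$ $(A\in S)$ are pairwise distinct and nontrivial (so the Cayley graph has no loops or multiple edges), the flag complex of the Cayley graph of $\Gamma_{\mathcal T}$ (the poset of its finite cliques, including the empty one, under inclusion) is isomorphic to $\Sigma$, and the Cayley graph of $\Gamma_{\mathcal T}$ is isomorphic, as a graph, to the 1-skeleton of $\Sigma$. -/

import Mathlib

open scoped Pointwise

/-! ### Simplicial complexes as posets

A simplicial complex is viewed as the poset of its simplices ordered by the face relation. The empty
simplex is included and is the least element, and an isomorphism of simplicial complexes is an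
isomorphism of posets. The vertices are the atoms. -/

/-- The flag complex of a graph: its simplices are the finite sets of pairwise adjacent vertices
(including the empty set), ordered by inclusion. -/
abbrev FlagComplex {V : Type*} (G : SimpleGraph V) : Type _ :=
  {s : Finset V // G.IsClique (s : Set V)}

/-- The 1-skeleton of a simplicial complex `P` (given as a poset of simplices), as a graph:
its vertices are the vertices of `P`, and two distinct vertices are adjacent when they are exactly
the vertices of some simplex of `P`. -/
def oneSkeleton (P : Type*) [PartialOrder P] [OrderBot P] : SimpleGraph {v : P // IsAtom v} where
  Adj v w := v ≠ w ∧ ∃ e : P, {u : {v : P // IsAtom v} | (u : P) ≤ e} = {v, w}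
  symm := ⟨fun v w h => ⟨h.1.symm, by
    obtain ⟨e, he⟩ := h.2
    exact ⟨e, by rw [he, Set.pair_comm]⟩⟩⟩
  loopless := ⟨fun _ h => h.1 rfl⟩

/-! ### The Coxeter complex -/

/-- The Coxeter matrix of type `Ã_{n-1}`: the Coxeter diagram is the cycle on `n` nodes if `3 ≤ n`,
and it consists of two nodes joined by an edge marked `∞` (encoded by the entry `0`) if `n = 2`. -/
def affineCoxeterMatrixA (n : ℕ) : CoxeterMatrix (Fin n) where
  M := Matrix.of fun i j : Fin n =>
    if i = j then 1
    else if n = 2 then 0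
    else if ((i : ℕ) + 1) % n = j ∨ ((j : ℕ) + 1) % n = i then 3
    else 2
  isSymm := by
    ext i j
    simp only [Matrix.transpose_apply, Matrix.of_apply, eq_comm (a := j) (b := i),
      or_comm (a := ((j : ℕ) + 1) % n = i)]
  diagonal := by simp
  off_diagonal := by
    intro i j h
    simp only [Matrix.of_apply, if_neg h]
    split_ifs <;> decide

namespace CoxeterSystem

variable {B W : Type*} [Group W] {M : CoxeterMatrix B} (cs : CoxeterSystem M W)

/-- The special subgroup `⟨J⟩` generated by a set `J` of simple reflections. -/
def specialSubgroup (J : Set B) : Subgroup W := Subgroup.closure (cs.simple '' J)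

/-- The special cosets `w⟨J⟩`, ordered by inclusion. -/
abbrev SpecialCoset : Type _ :=
  {C : Set W // ∃ (w : W) (J : Set B), C = w • (cs.specialSubgroup J : Set W)}

/-- The whole group is the largest special coset. -/
instance : OrderTop cs.SpecialCoset where
  top := ⟨Set.univ, 1, Set.univ, by
    simp [specialSubgroup, cs.subgroup_closure_range_simple]⟩
  le_top C := Set.subset_univ C.1

/-- The Coxeter complex `Σ(W, S)`: the poset of special cosets under the opposite of inclusion.
Its least element, the empty simplex, is the whole group. -/
abbrev CoxeterComplex : Type _ := (cs.SpecialCoset)ᵒᵈ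

end CoxeterSystem

/-! ### The degenerate triangle presentation -/

namespace DegenerateTriangle

/-- The proper nonempty subsets of the `n`-element set `X = Fin n`. -/
abbrev ProperSubset (n : ℕ) : Type := {a : Finset (Fin n) // a.Nonempty ∧ a ≠ Finset.univ}

/-- Complementation `σ(a) = X \ a` on the proper nonempty subsets. -/
def compl {n : ℕ} (a : ProperSubset n) : ProperSubset n :=
  ⟨(a : Finset (Fin n))ᶜ, by
    rw [Finset.nonempty_iff_ne_empty, Ne, Finset.compl_eq_empty_iff]
    exact a.2.2, by
    rw [Ne, Finset.compl_eq_univ_iff]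
    exact a.2.1.ne_empty⟩

/-- `T₁`: ordered triples of pairwise disjoint proper nonempty subsets with union `X`. -/
def T₁ (n : ℕ) : Set (ProperSubset n × ProperSubset n × ProperSubset n) :=
  {t | Disjoint t.1.1 t.2.1.1 ∧ Disjoint t.1.1 t.2.2.1 ∧ Disjoint t.2.1.1 t.2.2.1 ∧
    t.1.1 ∪ t.2.1.1 ∪ t.2.2.1 = Finset.univ}

/-- `T₂`: the triples `(A, B, C)` with `(σ(C), σ(B), σ(A)) ∈ T₁`. -/
def T₂ (n : ℕ) : Set (ProperSubset n × ProperSubset n × ProperSubset n) :=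
  {t | (compl t.2.2, compl t.2.1, compl t.1) ∈ T₁ n}

/-- The degenerate triangle presentation. -/
def T (n : ℕ) : Set (ProperSubset n × ProperSubset n × ProperSubset n) := T₁ n ∪ T₂ n

/-- The relators `g_a g_b g_c` for `(a, b, c) ∈ T` and `g_a g_{σ(a)}` for all `a`. -/
def relators (n : ℕ) : Set (FreeGroup (ProperSubset n)) :=
  {r | ∃ a b c, (a, b, c) ∈ T n ∧ r = FreeGroup.of a * FreeGroup.of b * FreeGroup.of c} ∪
    {r | ∃ a, r = FreeGroup.of a * FreeGroup.of (compl a)}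

/-- The group `Γ_T` presented by the generators `g_a` and these relators. -/
abbrev Gam (n : ℕ) : Type := PresentedGroup (relators n)

/-- The generator `g_a` of `Γ_T`. -/
def gen {n : ℕ} (a : ProperSubset n) : Gam n := PresentedGroup.of a

/-- The Cayley graph of `Γ_T` with respect to the generators `g_a`. -/
abbrev cayleyGraph (n : ℕ) : SimpleGraph (Gam n) :=
  SimpleGraph.mulCayley (Set.range (gen (n := n)))

end DegenerateTriangle

/-! Disjoint sets satisfy `g_A g_B = g_{A ∪ B}`, so `Γ_T` is abelian and generated by the
singletons. Sending `g_A` to the indicator of `A` identifies it with `ℤⁿ` modulo constants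
(`ofCoord_eq_iff`). Extending a vector to `x : ℤ → ℤ` by `x (m + n) = x m - 1` turns elements into
quasi-periodic functions modulo constants. Distinct elements are adjacent exactly when they have
lifts `x ≤ y ≤ x + 1`.

The Coxeter group acts on `ℤ` by affine permutations, hence on these functions by precomposition.
The antitone ones are, modulo constants, `vertexLift n j` for `0 ≤ j < n`: they are the vertices of
the fundamental chamber, and their translates give all chambers. Since `w` sends the root of `i` to
a negative root exactly when `i` is a right descent, induction on length shows that the simultaneous
stabilizer of the vertices with labels in `K` is `⟨Kᶜ⟩` (`mem_specialSubgroup_compl_iff`).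

The main point is that every clique lies in a chamber. A clique lifts to a chain in some interval
`[y, y + 1]`. Some `w` sorts the sum of the chain into an antitone function
(`exists_antitone_comp_affinePerm`), and this sorts every member (`antitone_of_antitone_sum`).
Simplices then correspond to special cosets through their stars. -/

/-! ### Coxeter complexes as flag complexes -/

namespace CoxeterSystem

variable {B W V : Type*} [Group W] {M : CoxeterMatrix B} (cs : CoxeterSystem M W)

/-- A labelled family of chambers `p w : B → V`, indexed by a Coxeter group, exhibits the flag
complex of a graph on `V` as the Coxeter complex. -/
theorem flagComplex_orderIso [Finite B] (G : SimpleGraph V) (p : W → B → V)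
    (hlabel : ∀ w u i j, p w i = p u j → i = j)
    (hstab : ∀ w u (K : Set B), (∀ i ∈ K, p w i = p u i) ↔ w⁻¹ * u ∈ cs.specialSubgroup Kᶜ)
    (hmove : ∀ i, p 1 i ≠ p (cs.simple i) i)
    (hclique : ∀ s : Finset V, G.IsClique (s : Set V) ↔ ∃ w, (s : Set V) ⊆ Set.range (p w)) :
    Nonempty (FlagComplex G ≃o cs.CoxeterComplex) := by
  classical
  -- A simplex corresponds to the set of chambers containing it. For the face of `w` with label set
  -- `K` this is the coset `w⟨Kᶜ⟩`.
  let star : Finset V → Set W := fun s => {u | (s : Set V) ⊆ Set.range (p u)}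
  have star_eq : ∀ (s : Finset V) w (K : Set B), (s : Set V) = p w '' K →
      star s = w • (cs.specialSubgroup Kᶜ : Set W) := by
    intro s w K hs
    ext u
    simp only [star, Set.mem_ofPred_eq, hs, Set.mem_smul_set_iff_inv_smul_mem, smul_eq_mul,
      SetLike.mem_coe, ← hstab]
    constructor
    · intro h i hi
      obtain ⟨j, hj⟩ := h (Set.mem_image_of_mem _ hi)
      obtain rfl := hlabel _ _ _ _ hj
      exact hj.symm
    · rintro h _ ⟨i, hi, rfl⟩
      exact ⟨i, (h i hi).symm⟩
  have face : ∀ (s : Finset V) w, (s : Set V) ⊆ Set.range (p w) →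
      (s : Set V) = p w '' (p w ⁻¹' s) := fun s w h => by
    rw [Set.image_preimage_eq_inter_range, Set.inter_eq_left.2 h]
  have le_iff : ∀ s t : FlagComplex G, star t.1 ⊆ star s.1 ↔ s ≤ t := by
    intro s t
    constructor
    · intro h
      obtain ⟨w, hw⟩ := (hclique t.1).1 t.2
      have hws : w ∈ star s.1 := h hw
      have ht := face _ _ hw
      have hs := face _ _ hws
      rw [star_eq _ _ _ ht, star_eq _ _ _ hs, Set.smul_set_subset_smul_set_iff] at h
      change (s.1 : Set V) ⊆ t.1 at *
      have hK : p w ⁻¹' (s.1 : Set V) ⊆ p w ⁻¹' t.1 := by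
        intro i hi
        by_contra hit
        -- If `i` labels a vertex of `s` but not of `t`, then `s_i` lies in the stabilizer of `t`,
        -- hence in that of `s`, although it moves the vertex labelled `i`.
        have h1 : cs.simple i ∈ cs.specialSubgroup (p w ⁻¹' (t.1 : Set V))ᶜ :=
          Subgroup.subset_closure (Set.mem_image_of_mem _ hit)
        have h2 := h h1
        have h3 := (hstab 1 (cs.simple i) (p w ⁻¹' (s.1 : Set V))).2 (by simpa using h2)
        exact hmove i (h3 i hi)
      rw [hs, ht]
      exact Set.image_mono hK
    · intro h u hu
      exact (Finset.coe_subset.2 h).trans hu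
  let f : FlagComplex G → cs.CoxeterComplex := fun s => OrderDual.toDual ⟨star s.1, by
    obtain ⟨w, hw⟩ := (hclique s.1).1 s.2
    exact ⟨w, _, star_eq _ _ _ (face _ _ hw)⟩⟩
  have hf : ∀ s t, f s ≤ f t ↔ s ≤ t := fun s t => le_iff s t
  refine ⟨RelIso.ofSurjective (OrderEmbedding.ofMapLEIff f hf) ?_⟩
  rintro ⟨C, w, J, rfl⟩
  have hfin : (p w '' Jᶜ).Finite := (Set.toFinite _).image _
  refine ⟨⟨hfin.toFinset, (hclique _).2 ⟨w, by simp⟩⟩, ?_⟩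
  refine congrArg OrderDual.toDual (Subtype.ext ?_)
  have := star_eq hfin.toFinset w Jᶜ (by simp)
  simpa using this

end CoxeterSystem

/-- A graph is the 1-skeleton of its flag complex. -/
theorem oneSkeleton_of_flagComplex_orderIso {V P : Type*} [PartialOrder P] [OrderBot P]
    (G : SimpleGraph V) (e : FlagComplex G ≃o P) : Nonempty (G ≃g oneSkeleton P) := by
  classical
  let pt : V → FlagComplex G := fun v => ⟨{v}, by simp⟩
  have hbot : e ⟨∅, by simp⟩ = ⊥ :=
    le_bot_iff.1 ((e.le_symm_apply).1 (show _ ≤ _ from Finset.empty_subset _))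
  have hpt : ∀ v s, e (pt v) ≤ e s ↔ v ∈ s.1 := fun v s => by
    rw [e.le_iff_le]; exact Finset.singleton_subset_iff
  have hatom : ∀ v, IsAtom (e (pt v)) := by
    intro v
    refine ⟨fun h => ?_, fun b hb => ?_⟩
    · rw [← hbot, e.injective.eq_iff] at h
      exact Finset.singleton_ne_empty v (congrArg Subtype.val h)
    · obtain ⟨s, rfl⟩ := e.surjective b
      rw [e.lt_iff_lt] at hb
      have h : s.1 ⊂ {v} := hb
      rw [Finset.ssubset_singleton_iff] at h
      rw [← hbot]
      exact congrArg e (Subtype.ext h)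
  let f : V → {v : P // IsAtom v} := fun v => ⟨e (pt v), hatom v⟩
  have finj : Function.Injective f := fun v w h => by
    have := e.injective (congrArg Subtype.val h)
    exact Finset.singleton_injective (congrArg Subtype.val this)
  have fsurj : Function.Surjective f := by
    rintro ⟨a, ha⟩
    obtain ⟨s, rfl⟩ := e.surjective a
    obtain ⟨v, hv⟩ : s.1.Nonempty := by
      rw [Finset.nonempty_iff_ne_empty]
      intro h
      apply ha.1
      rw [← hbot]
      exact congrArg e (Subtype.ext h)
    refine ⟨v, Subtype.ext ?_⟩
    exact (ha.le_iff.1 ((hpt v s).2 hv)).resolve_left (hatom v).1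
  refine ⟨⟨Equiv.ofBijective f ⟨finj, fsurj⟩, ?_⟩⟩
  intro v w
  change (f v ≠ f w ∧ _) ↔ _
  rw [finj.ne_iff]
  constructor
  · rintro ⟨hvw, b, hb⟩
    obtain ⟨s, rfl⟩ := e.surjective b
    have h1 : f v ∈ ({f v, f w} : Set _) := by simp
    have h2 : f w ∈ ({f v, f w} : Set _) := by simp
    have h1' : f v ∈ {u : {v : P // IsAtom v} | (u : P) ≤ e s} := hb ▸ h1
    have h2' : f w ∈ {u : {v : P // IsAtom v} | (u : P) ≤ e s} := hb ▸ h2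
    exact s.2 ((hpt v s).1 h1') ((hpt w s).1 h2') hvw
  · intro h
    refine ⟨h.ne, e ⟨{v, w}, by simpa using fun _ => h⟩, ?_⟩
    ext u
    obtain ⟨u, rfl⟩ := fsurj u
    change e (pt u) ≤ _ ↔ _
    rw [hpt]
    change _ ↔ f u ∈ ({f v, f w} : Set _)
    simp [finj.eq_iff]

/-! ### Affine permutations -/

section AffinePermutations

variable {n : ℕ}

theorem ZMod.two_ne_zero_of_two_lt {n : ℕ} (hn : 2 < n) : (2 : ZMod n) ≠ 0 := by
  intro h
  have : ((2 : ℕ) : ZMod n) = 0 := by exact_mod_cast h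
  rw [ZMod.natCast_eq_zero_iff] at this
  exact absurd (Nat.le_of_dvd two_pos this) (by omega)

theorem Fin.natCast_zmod_injective {i j : Fin n} (h : ((i : ℕ) : ZMod n) = ((j : ℕ) : ZMod n)) :
    i = j := by
  rw [ZMod.natCast_eq_natCast_iff', Nat.mod_eq_of_lt i.2, Nat.mod_eq_of_lt j.2] at h
  exact Fin.ext h

theorem Fin.add_one_mod_eq_iff (i j : Fin n) :
    ((i : ℕ) + 1) % n = j ↔ ((j : ℕ) : ZMod n) = ((i : ℕ) : ZMod n) + 1 := by
  rw [← Nat.cast_succ, ZMod.natCast_eq_natCast_iff', Nat.mod_eq_of_lt j.2, eq_comm]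

theorem affineCoxeterMatrixA_apply_of_not_adj (hn : 2 < n) {i j : Fin n} (hij : i ≠ j)
    (h : ((j : ℕ) : ZMod n) ≠ ((i : ℕ) : ZMod n) + 1)
    (h' : ((i : ℕ) : ZMod n) ≠ ((j : ℕ) : ZMod n) + 1) : affineCoxeterMatrixA n i j = 2 := by
  simp [affineCoxeterMatrixA, hij, hn.ne', Fin.add_one_mod_eq_iff, h, h']

theorem affineCoxeterMatrixA_apply_of_two {i j : Fin n} (hn : n = 2) (hij : i ≠ j) :
    affineCoxeterMatrixA n i j = 0 := by
  simp [affineCoxeterMatrixA, hij, hn]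

variable [Fact (1 < n)]

theorem affineCoxeterMatrixA_apply_of_adj (hn : 2 < n) {i j : Fin n}
    (h : ((j : ℕ) : ZMod n) = ((i : ℕ) : ZMod n) + 1) : affineCoxeterMatrixA n i j = 3 := by
  have hij : i ≠ j := by rintro rfl; simp at h
  change (affineCoxeterMatrixA n).M i j = 3
  simp [affineCoxeterMatrixA, hij, hn.ne', Fin.add_one_mod_eq_iff, h]

/-- The permutation of `ℤ` which exchanges `m - 1` and `m` for all `m` in the class `i`. -/
def affineSwap (i : ZMod n) : Equiv.Perm ℤ :=
  Function.Involutive.toPerm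
    (fun m => if (m : ZMod n) = i then m - 1 else if (m : ZMod n) = i - 1 then m + 1 else m) <| by
    intro m
    by_cases h1 : (m : ZMod n) = i
    · simp [h1]
    · by_cases h2 : (m : ZMod n) = i - 1
      · simp [h2]
      · simp [h1, h2]

theorem affineSwap_of_eq {i : ZMod n} {m : ℤ} (h : (m : ZMod n) = i) :
    affineSwap i m = m - 1 := if_pos h

theorem affineSwap_of_eq_sub_one {i : ZMod n} {m : ℤ} (h : (m : ZMod n) = i - 1) :
    affineSwap i m = m + 1 := (if_neg (by simp [h])).trans (if_pos h)

theorem affineSwap_of_ne {i : ZMod n} {m : ℤ} (h : (m : ZMod n) ≠ i) (h' : (m : ZMod n) ≠ i - 1) :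
    affineSwap i m = m := (if_neg h).trans (if_neg h')

theorem affineSwap_apply (i : ZMod n) (m : ℤ) :
    affineSwap i m =
      if (m : ZMod n) = i then m - 1 else if (m : ZMod n) = i - 1 then m + 1 else m := rfl

theorem affineSwap_mul_self (i : ZMod n) : affineSwap i * affineSwap i = 1 :=
  Equiv.ext (fun m => (affineSwap i).left_inv m)

theorem affineSwap_add (i : ZMod n) (m : ℤ) : affineSwap i (m + n) = affineSwap i m + n := by
  simp only [affineSwap_apply]
  push_cast
  simp only [CharP.cast_eq_zero, add_zero]
  split_ifs <;> ring

theorem affineSwap_braid (hn : 2 < n) (i : ZMod n) :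
    (affineSwap i * affineSwap (i + 1)) ^ 3 = 1 := by
  have h2 := ZMod.two_ne_zero_of_two_lt hn
  have h2' : (1 : ZMod n) + 1 ≠ 0 := by rwa [one_add_one_eq_two]
  ext m
  have h3 : (-1 : ZMod n) ≠ 1 := fun h => h2' (by rw [← neg_add_cancel (1 : ZMod n), h])
  -- Only the classes `i - 1`, `i`, `i + 1` are moved. They are distinct because `2 ≠ 0`, so `r = 1,
  -- 0, -1` are the only cases needing computation.
  obtain ⟨r, hr⟩ : ∃ r, (m : ZMod n) = i + r := ⟨m - i, by ring⟩
  simp only [pow_succ, pow_zero, one_mul, Equiv.Perm.mul_apply, Equiv.Perm.one_apply]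
  simp only [affineSwap_apply, apply_ite (Int.cast : ℤ → ZMod n), Int.cast_add, Int.cast_one,
    hr, sub_eq_add_neg, add_assoc, add_right_inj]
  by_cases r1 : r = 1
  · subst r1; simp [h3, h3.symm]
  by_cases r0 : r = 0
  · subst r0; simp [h3, h3.symm]
  by_cases rm : r = -1
  · subst rm; simp [h3, h3.symm]
  simp [r1, r0, rm]

theorem affineSwap_commute {i j : ZMod n} (h : i ≠ j) (h1 : j ≠ i + 1) (h2 : i ≠ j + 1) :
    (affineSwap i * affineSwap j) ^ 2 = 1 := by
  have h' := h.symm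
  have h1' : j - 1 ≠ i := fun h => h1 (by rw [← h]; ring)
  have h2' : i - 1 ≠ j := fun h => h2 (by rw [← h]; ring)
  ext m
  simp only [pow_succ, pow_zero, one_mul, Equiv.Perm.mul_apply, Equiv.Perm.one_apply]
  by_cases e1 : (m : ZMod n) = i
  · have : ((m - 1 : ℤ) : ZMod n) = i - 1 := by simp [e1]
    rw [affineSwap_of_ne (i := j) (m := m) (e1 ▸ h) (e1 ▸ h1'.symm), affineSwap_of_eq e1,
      affineSwap_of_ne (i := j) (by rwa [this]) (by rw [this]; simpa using h),
      affineSwap_of_eq_sub_one this]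
    ring
  by_cases e2 : (m : ZMod n) = i - 1
  · have : ((m + 1 : ℤ) : ZMod n) = i := by simp [e2]
    rw [affineSwap_of_ne (i := j) (m := m) (e2 ▸ h2') (by rw [e2]; simpa using h),
      affineSwap_of_eq_sub_one e2,
      affineSwap_of_ne (i := j) (by rwa [this]) (by rw [this]; exact h1'.symm),
      affineSwap_of_eq this]
    ring
  by_cases e3 : (m : ZMod n) = j
  · have : ((m - 1 : ℤ) : ZMod n) = j - 1 := by simp [e3]
    rw [affineSwap_of_eq e3, affineSwap_of_ne (i := i) (m := m - 1) (by rw [this]; exact h1')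
      (by rw [this]; simpa using h'), affineSwap_of_eq_sub_one this,
      affineSwap_of_ne (by simpa using e1) (by simpa using e2)]
    ring
  by_cases e4 : (m : ZMod n) = j - 1
  · have : ((m + 1 : ℤ) : ZMod n) = j := by simp [e4]
    rw [affineSwap_of_eq_sub_one e4, affineSwap_of_ne (i := i) (m := m + 1) (by rw [this]; exact h')
      (by rw [this]; exact h2'.symm), affineSwap_of_eq this,
      affineSwap_of_ne (by simpa using e1) (by simpa using e2)]
    ring
  rw [affineSwap_of_ne e3 e4, affineSwap_of_ne e1 e2, affineSwap_of_ne e3 e4,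
    affineSwap_of_ne e1 e2]

theorem affineSwap_isLiftable :
    (affineCoxeterMatrixA n).IsLiftable fun i : Fin n => affineSwap ((i : ℕ) : ZMod n) := by
  have hn : 1 < n := Fact.out
  intro i j
  beta_reduce
  by_cases hij : i = j
  · subst hij; simp [affineSwap_mul_self]
  rcases (Nat.succ_le_of_lt hn).eq_or_lt with h2 | h2
  · simp [affineCoxeterMatrixA_apply_of_two h2.symm hij]
  by_cases h : ((j : ℕ) : ZMod n) = ((i : ℕ) : ZMod n) + 1
  · rw [affineCoxeterMatrixA_apply_of_adj h2 h, h, affineSwap_braid h2]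
  by_cases h' : ((i : ℕ) : ZMod n) = ((j : ℕ) : ZMod n) + 1
  · rw [CoxeterMatrix.symmetric, affineCoxeterMatrixA_apply_of_adj h2 h', h', ← inv_inj, ← inv_pow,
      mul_inv_rev, inv_one, inv_eq_of_mul_eq_one_left (affineSwap_mul_self _),
      inv_eq_of_mul_eq_one_left (affineSwap_mul_self _), affineSwap_braid h2]
  · rw [affineCoxeterMatrixA_apply_of_not_adj h2 hij h h', affineSwap_commute
      (fun h => hij (Fin.natCast_zmod_injective h)) h h']

end AffinePermutations

/-! ### Descents and stabilizers for the affine action on `ℤ` -/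

namespace CoxeterSystem

section Braid

variable {B W : Type*} [Group W] {M : CoxeterMatrix B} (cs : CoxeterSystem M W)

theorem simple_mul_comm_of_eq_two {i j : B} (h : M i j = 2) :
    cs.simple i * cs.simple j = cs.simple j * cs.simple i := by
  have := cs.simple_mul_simple_pow i j
  rw [h, pow_two, mul_eq_one_iff_eq_inv, mul_inv_rev, cs.inv_simple, cs.inv_simple] at this
  exact this

theorem simple_braid_of_eq_three {i j : B} (h : M i j = 3) :
    cs.simple i * cs.simple j * cs.simple i = cs.simple j * cs.simple i * cs.simple j := by
  have := cs.simple_mul_simple_pow i j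
  rw [h] at this
  have h' : cs.simple i * cs.simple j * cs.simple i * (cs.simple j * cs.simple i * cs.simple j) =
      1 := by
    rw [← this]; simp only [pow_succ, pow_zero, one_mul, mul_assoc]
  rw [mul_eq_one_iff_eq_inv, mul_inv_rev, mul_inv_rev, cs.inv_simple, cs.inv_simple] at h'
  rw [h', mul_assoc]

theorem length_mul_simple_le (w : W) (i : B) : cs.length (w * cs.simple i) ≤ cs.length w + 1 := by
  rcases cs.length_mul_simple w i with h | h <;> omega

end Braid

variable {n : ℕ} [Fact (1 < n)] {W : Type*} [Group W]
  (cs : CoxeterSystem (affineCoxeterMatrixA n) W)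

/-- The action of a Coxeter group of type `Ã_{n-1}` on `ℤ` by affine permutations. -/
def affinePerm : W →* Equiv.Perm ℤ := cs.lift ⟨_, affineSwap_isLiftable⟩

theorem affinePerm_simple (i : Fin n) :
    cs.affinePerm (cs.simple i) = affineSwap ((i : ℕ) : ZMod n) :=
  cs.lift_apply_simple affineSwap_isLiftable i

theorem affinePerm_mul_simple_apply (w : W) (i : Fin n) (m : ℤ) :
    cs.affinePerm (w * cs.simple i) m = cs.affinePerm w (affineSwap ((i : ℕ) : ZMod n) m) := by
  rw [map_mul, affinePerm_simple, Equiv.Perm.mul_apply]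

theorem affinePerm_add (w : W) (m : ℤ) :
    cs.affinePerm w (m + n) = cs.affinePerm w m + n := by
  induction w using cs.simple_induction_right generalizing m with
  | one => simp
  | mul_simple_right w i ih =>
    rw [affinePerm_mul_simple_apply, affinePerm_mul_simple_apply, affineSwap_add, ih]

theorem affinePerm_add_mul (w : W) (m k : ℤ) :
    cs.affinePerm w (m + k * n) = cs.affinePerm w m + k * n := by
  induction k using Int.induction_on with
  | zero => simp
  | succ k ih => rw [add_one_mul, ← add_assoc, affinePerm_add, ih, add_assoc]
  | pred k ih =>
    rw [← add_left_inj (n : ℤ), ← affinePerm_add]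
    simpa [sub_mul, add_assoc] using ih

/-- If `i` is not a right descent of `w`, then `w` maps the root of `i` to a positive root. -/
theorem affinePerm_lt_of_not_isRightDescent (w : W) (i : Fin n) (h : ¬cs.IsRightDescent w i)
    (m : ℤ) (hm : (m : ZMod n) = ((i : ℕ) : ZMod n)) :
    cs.affinePerm w (m - 1) < cs.affinePerm w m := by
  have hn : 1 < n := Fact.out
  induction hl : cs.length w using Nat.strong_induction_on generalizing w i m with
  | _ l IH =>
  subst hl
  by_cases hw : w = 1
  · simp [hw]
  obtain ⟨j, hj⟩ := cs.exists_rightDescent_of_ne_one hw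
  -- Strip off a descent `j ≠ i`. It remains to compare the values of the shorter element `u` at the
  -- images of `m - 1` and `m` under `affineSwap j`.
  obtain ⟨u, rfl⟩ : ∃ u, w = u * cs.simple j := ⟨w * cs.simple j, by simp⟩
  have hji : i ≠ j := by rintro rfl; exact h hj
  rw [isRightDescent_iff, simple_mul_simple_cancel_right] at hj
  rw [not_isRightDescent_iff] at h
  have huj : ¬cs.IsRightDescent u j := by rw [not_isRightDescent_iff]; omega
  have hu := fun i h m hm => IH (cs.length u) (by omega) u i h m hm rfl
  have huj' := hu j huj
  rw [affinePerm_mul_simple_apply, affinePerm_mul_simple_apply]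
  have hne : ((i : ℕ) : ZMod n) ≠ ((j : ℕ) : ZMod n) :=
    fun h => hji (Fin.natCast_zmod_injective h)
  rcases (Nat.succ_le_of_lt hn).eq_or_lt with h2 | h2
  -- For `n = 2` the images are `m - 2` and `m + 1`, and `u (m - 2) = u m - 2 < u (m + 1)`.
  · have two : (1 : ZMod n) + 1 = 0 := by
      rw [one_add_one_eq_two]
      exact_mod_cast (ZMod.natCast_eq_zero_iff 2 n).2 (by rw [← h2])
    have hij : ((j : ℕ) : ZMod n) = ((i : ℕ) : ZMod n) + 1 := by
      have key : ∀ a b : ZMod 2, a ≠ b → b = a + 1 := by decide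
      subst h2
      exact key _ _ hne
    have hmj : ((m + 1 : ℤ) : ZMod n) = ((j : ℕ) : ZMod n) := by simp [hm, hij]
    have hmj' : ((m - 1 : ℤ) : ZMod n) = ((j : ℕ) : ZMod n) := by
      rw [← hmj]; push_cast
      rw [sub_eq_iff_eq_add, add_assoc, two, add_zero]
    rw [affineSwap_of_eq hmj', affineSwap_of_eq_sub_one (m := m) (by simp [hm, hij])]
    have h3 := huj' _ hmj
    have h4 := cs.affinePerm_add u (m - 1 - 1)
    rw [show m - 1 - 1 + (n : ℤ) = m by rw [← h2]; push_cast; ring] at h4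
    rw [add_sub_cancel_right] at h3
    omega
  have h2' := ZMod.two_ne_zero_of_two_lt h2
  -- in the rank two parabolic subgroup of type `A₂`
  have hbraid : affineCoxeterMatrixA n i j = 3 → cs.IsRightDescent u i →
      ∀ m : ℤ, (m : ZMod n) = ((j : ℕ) : ZMod n) → ∃ v, u = v * cs.simple i ∧
        cs.affinePerm v (m - 1) < cs.affinePerm v m := by
    intro hM hui m hm
    refine ⟨u * cs.simple i, by simp, ?_⟩
    rw [isRightDescent_iff] at hui
    refine IH (cs.length (u * cs.simple i)) (by omega) _ j ?_ m hm rfl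
    -- Put `v = u s_i`. If `j` were a descent of `v`, the braid relation `u s_j s_i = v s_j s_i s_j`
    -- would bound this length by `ℓ(u)`, whereas it is `ℓ(u) + 2`.
    intro hd
    rw [isRightDescent_iff] at hd
    have e : u * cs.simple j * cs.simple i =
        u * cs.simple i * cs.simple j * cs.simple i * cs.simple j := by
      have := cs.simple_braid_of_eq_three hM
      calc u * cs.simple j * cs.simple i
          = u * cs.simple i * (cs.simple i * cs.simple j * cs.simple i) := by
            simp [← mul_assoc]
        _ = _ := by rw [this]; simp only [← mul_assoc]
    have l1 := cs.length_mul_simple_le (u * cs.simple i * cs.simple j) i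
    have l2 := cs.length_mul_simple_le (u * cs.simple i * cs.simple j * cs.simple i) j
    rw [← e] at l2
    omega
  -- Here `m - 1` is fixed and `m` goes to `m + 1`. Either `u (m - 1) < u m < u (m + 1)`, or `u = v
  -- s_i` and the claim becomes `v m < v (m + 1)`. The case `i = j + 1` is the mirror image.
  by_cases h3 : ((j : ℕ) : ZMod n) = ((i : ℕ) : ZMod n) + 1
  · have hmj : ((m + 1 : ℤ) : ZMod n) = ((j : ℕ) : ZMod n) := by simp [hm, h3]
    have e1 : affineSwap ((j : ℕ) : ZMod n) (m - 1) = m - 1 := by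
      apply affineSwap_of_ne
      · rw [← hmj]; push_cast
        intro h; apply h2'
        linear_combination - h
      · rw [h3]; simp [hm]
    rw [e1, affineSwap_of_eq_sub_one (m := m) (by simp [hm, h3])]
    have h4 := huj' _ hmj
    rw [add_sub_cancel_right] at h4
    by_cases hui : cs.IsRightDescent u i
    · obtain ⟨v, rfl, hv⟩ := hbraid (affineCoxeterMatrixA_apply_of_adj h2 h3) hui _ hmj
      rw [affinePerm_mul_simple_apply, affinePerm_mul_simple_apply,
        affineSwap_of_eq_sub_one (m := m - 1) (by simp [hm]), affineSwap_of_ne (m := m + 1)]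
      · simpa using hv
      · simp [hm]
      · push_cast
        rw [hm]
        intro h; apply h2'
        linear_combination h
    · exact (hu i hui m hm).trans h4
  by_cases h3' : ((i : ℕ) : ZMod n) = ((j : ℕ) : ZMod n) + 1
  · have hmj : ((m - 1 : ℤ) : ZMod n) = ((j : ℕ) : ZMod n) := by simp [hm, h3']
    have e1 : affineSwap ((j : ℕ) : ZMod n) m = m := by
      apply affineSwap_of_ne
      · rw [hm]; exact hne
      · rw [hm, h3']
        intro h; apply h2'
        linear_combination h
    rw [e1, affineSwap_of_eq hmj]
    have h4 := huj' _ hmj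
    by_cases hui : cs.IsRightDescent u i
    · have hM := affineCoxeterMatrixA_apply_of_adj h2 h3'
      rw [CoxeterMatrix.symmetric] at hM
      obtain ⟨v, rfl, hv⟩ := hbraid hM hui _ hmj
      rw [affinePerm_mul_simple_apply, affinePerm_mul_simple_apply,
        affineSwap_of_eq (m := m) hm, affineSwap_of_ne (m := m - 1 - 1)]
      · exact hv
      · push_cast
        rw [hm]
        intro h; apply h2'
        linear_combination - h
      · push_cast
        rw [hm]
        simp
    · exact h4.trans (hu i hui m hm)
  · rw [affineSwap_of_ne, affineSwap_of_ne]
    · refine hu i ?_ m hm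
      intro hd
      rw [isRightDescent_iff] at hd
      have e := cs.simple_mul_comm_of_eq_two
        (affineCoxeterMatrixA_apply_of_not_adj h2 hji h3 h3')
      rw [mul_assoc, ← e, ← mul_assoc] at h
      have := cs.length_mul_simple_le (u * cs.simple i) j
      omega
    · rwa [hm]
    · rw [hm]; exact fun h => h3 (by rw [h]; ring)
    · push_cast; rw [hm]; exact fun h => h3' (by rw [← h]; ring)
    · push_cast; rw [hm]; simpa using hne

theorem affinePerm_lt_of_isRightDescent (w : W) (i : Fin n) (h : cs.IsRightDescent w i)
    (m : ℤ) (hm : (m : ZMod n) = ((i : ℕ) : ZMod n)) :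
    cs.affinePerm w m < cs.affinePerm w (m - 1) := by
  rw [isRightDescent_iff_not_isRightDescent_mul] at h
  have := cs.affinePerm_lt_of_not_isRightDescent _ i h m hm
  rwa [affinePerm_mul_simple_apply, affinePerm_mul_simple_apply, affineSwap_of_eq hm,
    affineSwap_of_eq_sub_one (by simp [hm]), sub_add_cancel] at this

/-- `affinePerm (cs.simple i)` preserves the half-line `m < j` for `j ≠ i`. -/
theorem affinePerm_simple_lt_iff {i j : Fin n} (h : i ≠ j) (m : ℤ) :
    cs.affinePerm (cs.simple i) m < (j : ℕ) ↔ m < (j : ℕ) := by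
  have hne : ((j : ℕ) : ZMod n) ≠ ((i : ℕ) : ZMod n) :=
    fun h' => h (Fin.natCast_zmod_injective h'.symm)
  rw [affinePerm_simple]
  by_cases h1 : (m : ZMod n) = ((i : ℕ) : ZMod n)
  · rw [affineSwap_of_eq h1]
    have : m ≠ (j : ℕ) := by rintro rfl; exact hne (by simpa using h1)
    omega
  by_cases h2 : (m : ZMod n) = ((i : ℕ) : ZMod n) - 1
  · rw [affineSwap_of_eq_sub_one h2]
    have : m + 1 ≠ (j : ℕ) := by
      intro h3
      apply hne
      have : ((m + 1 : ℤ) : ZMod n) = ((j : ℕ) : ZMod n) := by rw [h3]; simp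
      rw [← this]
      simp [h2]
    omega
  · rw [affineSwap_of_ne h1 h2]

/-- The simultaneous stabilizer of the half-lines `m < j` for `j ∈ K`. -/
theorem mem_specialSubgroup_compl_iff (K : Set (Fin n)) (w : W) :
    w ∈ cs.specialSubgroup Kᶜ ↔
      ∀ j ∈ K, ∀ m : ℤ, cs.affinePerm w m < (j : ℕ) ↔ m < (j : ℕ) := by
  constructor
  · intro h j hj
    induction h using Subgroup.closure_induction with
    | mem x hx =>
      obtain ⟨i, hi, rfl⟩ := hx
      exact cs.affinePerm_simple_lt_iff (by rintro rfl; exact hi hj)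
    | one => simp
    | mul x y _ _ hx hy => intro m; rw [map_mul, Equiv.Perm.mul_apply, hx, hy]
    | inv x _ hx => intro m; rw [← hx, ← Equiv.Perm.mul_apply, ← map_mul]; simp
  · intro h
    induction hl : cs.length w using Nat.strong_induction_on generalizing w with
    | _ l IH =>
    subst hl
    by_cases hw : w = 1
    · rw [hw]; exact one_mem _
    obtain ⟨i, hi⟩ := cs.exists_rightDescent_of_ne_one hw
    -- A descent `i ∈ K` would give `w i < w (i - 1) < i`, so `w` would move `i` into the half-line
    -- `m < i`.
    have hiK : i ∉ K := by
      intro hiK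
      have h1 := cs.affinePerm_lt_of_isRightDescent w i hi (i : ℕ) (by simp)
      have h2 := (h i hiK (i : ℕ)).1
      have h3 := (h i hiK ((i : ℕ) - 1)).2 (by omega)
      exact absurd (h2 (h1.trans h3)) (lt_irrefl _)
    have := IH _ hi (w * cs.simple i) (fun j hj m => by
      rw [map_mul, Equiv.Perm.mul_apply, h j hj,
        cs.affinePerm_simple_lt_iff (by rintro rfl; exact hiK hj)]) rfl
    have h4 : cs.simple i ∈ cs.specialSubgroup Kᶜ :=
      Subgroup.subset_closure (Set.mem_image_of_mem _ hiK)
    simpa using mul_mem this h4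

end CoxeterSystem

/-! ### Quasi-periodic functions and lattice vertices -/

section QuasiPeriodic

variable {n : ℕ}

theorem Fintype.sum_sub_sum_of_eq_off_pair {ι : Type*} [Fintype ι] [DecidableEq ι] {f g : ι → ℤ}
    {p q : ι} (hpq : p ≠ q) (h : ∀ a, a ≠ p → a ≠ q → f a = g a) :
    ∑ a, f a - ∑ a, g a = (f p - g p) + (f q - g q) := by
  rw [← Finset.sum_sub_distrib, ← Finset.sum_pair (f := fun a => f a - g a) hpq]
  symm
  apply Finset.sum_subset (Finset.subset_univ _)
  intro a _ ha
  simp only [Finset.mem_insert, Finset.mem_singleton, not_or] at ha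
  rw [h a ha.1 ha.2, sub_self]

/-- A family of functions with values in a common unit interval, pairwise comparable, is
simultaneously antitone when its sum is. -/
theorem antitone_of_antitone_sum {ι : Type*} {s : Finset ι} {x : ι → ℤ → ℤ} {y : ℤ → ℤ}
    (hle : ∀ u ∈ s, ∀ m, y m ≤ x u m) (hle' : ∀ u ∈ s, ∀ m, x u m ≤ y m + 1)
    (hcomp : ∀ u ∈ s, ∀ v ∈ s, x u ≤ x v ∨ x v ≤ x u)
    (h : Antitone fun m => ∑ u ∈ s, x u m) : ∀ u ∈ s, Antitone (x u) := by
  intro v hv p q hpq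
  by_contra! hlt
  obtain ⟨u, hu, huv⟩ : ∃ u ∈ s, x u q < x u p := by
    by_contra! hno
    exact absurd (h hpq) (not_le.2 (Finset.sum_lt_sum hno ⟨v, hv, hlt⟩))
  have h1 := hle u hu p
  have h2 := hle' u hu p
  have h3 := hle v hv p
  have h4 := hle' v hv p
  have h5 := hle u hu q
  have h6 := hle' u hu q
  have h7 := hle v hv q
  have h8 := hle' v hv q
  -- Between `p` and `q`, `x v` rises and `x u` falls. If `x u ≤ x v` they differ by at least two at
  -- `q`, otherwise at `p`; an interval of length one has no room for this.
  rcases hcomp u hu v hv with hc | hc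
  · have h9 : x u p ≤ x v p := hc p
    have h10 : x u q ≤ x v q := hc q
    omega
  · have h9 : x v p ≤ x u p := hc p
    have h10 : x v q ≤ x u q := hc q
    omega

theorem quasiPeriodic_mul {x : ℤ → ℤ} {k : ℤ} (hx : ∀ m, x (m + n) = x m - k) (m l : ℤ) :
    x (m + l * n) = x m - l * k := by
  induction l using Int.induction_on with
  | zero => simp
  | succ l ih => rw [add_one_mul, ← add_assoc, hx, ih]; ring
  | pred l ih =>
    have := hx (m + (-l - 1) * n)
    rw [show m + (-(l : ℤ) - 1) * n + n = m + -l * n by ring, ih] at this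
    linarith

theorem quasiPeriodic_comp_affineSwap [Fact (1 < n)] {x : ℤ → ℤ} {k : ℤ} (hx : ∀ m, x (m + n) = x m - k)
    (i : ZMod n) (m : ℤ) : (x ∘ affineSwap i) (m + n) = (x ∘ affineSwap i) m - k := by
  rw [Function.comp_apply, affineSwap_add, hx, Function.comp_apply]

variable [NeZero n]

/-- The lift to `ℤ` of the `j`-th vertex of the fundamental chamber: it is characterized by
`k < vertexLift n j m ↔ m < j - k * n`. -/
def vertexLift (n : ℕ) (j m : ℤ) : ℤ := -((m - j) / n)

theorem lt_vertexLift_iff (j m k : ℤ) : k < vertexLift n j m ↔ m < j - k * n := by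
  have hn : (0 : ℤ) < n := by exact_mod_cast Nat.pos_of_neZero n
  rw [vertexLift, lt_neg, Int.ediv_lt_iff_lt_mul hn, neg_mul]
  omega

theorem vertexLift_pos_iff (j m : ℤ) : 0 < vertexLift n j m ↔ m < j := by
  simp [lt_vertexLift_iff]

theorem vertexLift_add_mul (j m c : ℤ) : vertexLift n (j + c * n) m = vertexLift n j m + c := by
  refine eq_of_forall_lt_iff fun k => ?_
  rw [← sub_lt_iff_lt_add, lt_vertexLift_iff, lt_vertexLift_iff, sub_mul]
  constructor <;> intro h <;> linarith

theorem vertexLift_add (j m : ℤ) : vertexLift n j (m + n) = vertexLift n j m - 1 := by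
  refine eq_of_forall_lt_iff fun k => ?_
  rw [lt_sub_iff_add_lt, lt_vertexLift_iff, lt_vertexLift_iff, add_mul]
  constructor <;> intro h <;> linarith

theorem vertexLift_mono {i j : ℤ} (h : i ≤ j) (m : ℤ) : vertexLift n i m ≤ vertexLift n j m :=
  le_of_forall_lt fun k hk => by
    rw [lt_vertexLift_iff] at hk ⊢
    omega

theorem vertexLift_le_add_one {i j : ℤ} (h : j ≤ i + n) (m : ℤ) :
    vertexLift n j m ≤ vertexLift n i m + 1 := by
  rw [← vertexLift_add_mul, one_mul]
  exact vertexLift_mono h m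

/-- The function on `ℤ / n` induced by the `n`-periodic function `n * x m + k * m`, where
`x (m + n) = x m - k`. -/
def cyclicCoord (k : ℤ) (x : ℤ → ℤ) (a : ZMod n) : ℤ := n * x a.val + k * a.val

theorem cyclicCoord_intCast {x : ℤ → ℤ} {k : ℤ} (hx : ∀ m, x (m + n) = x m - k) (m : ℤ) :
    cyclicCoord k x (m : ZMod n) = n * x m + k * m := by
  rw [cyclicCoord, ZMod.val_intCast]
  have := quasiPeriodic_mul hx (m % n) (m / n)
  rw [Int.emod_add_ediv_mul] at this
  rw [this]
  linear_combination k * Int.emod_add_ediv_mul m n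

/-- This sum is invariant under the Coxeter group and thus recovers the label of a vertex.
Strictness for `i < j` is seen at the class of `i`, where the lift of `j` is positive and that of
`i` is not. -/
theorem sum_cyclicCoord_vertexLift_strictMono :
    StrictMono fun j : ℤ => ∑ a : ZMod n, cyclicCoord 1 (vertexLift n j) a := by
  have hn : (0 : ℤ) < n := by exact_mod_cast Nat.pos_of_neZero n
  intro i j hij
  refine Finset.sum_lt_sum (fun a _ => ?_) ⟨(i : ZMod n), Finset.mem_univ _, ?_⟩
  · exact add_le_add_left (mul_le_mul_of_nonneg_left (vertexLift_mono hij.le _) hn.le) _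
  · rw [cyclicCoord_intCast (vertexLift_add i), cyclicCoord_intCast (vertexLift_add j)]
    refine add_lt_add_left (mul_lt_mul_of_pos_left ?_ hn) _
    have h1 : ¬ 0 < vertexLift n i i := by simp [vertexLift_pos_iff]
    have h2 := (vertexLift_pos_iff (n := n) j i).2 hij
    omega

/-- Up to additive constants, the antitone functions with `x (m + n) = x m - 1` are the vertices
of the fundamental chamber. -/
theorem exists_eq_vertexLift_add_of_antitone {x : ℤ → ℤ} (hx : ∀ m, x (m + n) = x m - 1)
    (h : Antitone x) : ∃ (j : Fin n) (c : ℤ), ∀ m, x m = vertexLift n (j : ℕ) m + c := by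
  classical
  have hn := Nat.pos_of_neZero n
  -- Since `x (-1) = c + 1`, on `0, …, n - 1` the function takes only the values `c + 1` and `c`.
  -- The label is the first place where it equals `c`.
  set c := x (n - 1 : ℕ) with hc
  have hex : ∃ j : ℕ, x j = c := ⟨n - 1, rfl⟩
  have hle : Nat.find hex ≤ n - 1 := Nat.find_min' hex rfl
  refine ⟨⟨Nat.find hex, by omega⟩, c, ?_⟩
  have hspec := Nat.find_spec hex
  have hx1 : x (-1) = c + 1 := by
    have := hx (-1)
    rw [show (-1 : ℤ) + n = (n - 1 : ℕ) by push_cast [hn]; ring, ← hc] at this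
    omega
  have hwin : ∀ m : ℤ, 0 ≤ m → m < n → x m = vertexLift n (Nat.find hex) m + c := by
    intro m hm0 hmn
    lift m to ℕ using hm0
    have h1 : c ≤ x m := h (by omega)
    have h2 : x m ≤ c + 1 := hx1 ▸ h (by omega)
    have v1 := vertexLift_pos_iff (n := n) (Nat.find hex) m
    have v2 := lt_vertexLift_iff (n := n) (Nat.find hex) m 1
    have v3 := lt_vertexLift_iff (n := n) (Nat.find hex) m (-1)
    by_cases hlt : m < Nat.find hex
    · have := Nat.find_min hex hlt
      omega
    · have : x m ≤ c := hspec ▸ h (by omega)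
      omega
  intro m
  have hn' : (n : ℤ) ≠ 0 := by exact_mod_cast hn.ne'
  have := hwin (m % n) (Int.emod_nonneg _ hn') (Int.emod_lt_of_pos _ (by omega))
  rw [← Int.emod_add_ediv_mul m n, quasiPeriodic_mul hx, this,
    quasiPeriodic_mul (vertexLift_add _)]
  ring

variable [Fact (1 < n)]

theorem cyclicCoord_comp_affineSwap_of_ne {x : ℤ → ℤ} {k : ℤ} {i a : ZMod n}
    (h : a ≠ i - 1) (h' : a ≠ i) : cyclicCoord k (x ∘ affineSwap i) a = cyclicCoord k x a := by
  rw [cyclicCoord, Function.comp_apply, affineSwap_of_ne (by simpa using h') (by simpa using h),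
    cyclicCoord]

/-- In these coordinates `affineSwap i` exchanges the entries at `i - 1` and `i` up to a correction
`± k`: it is an affine reflection preserving the sum. -/
theorem cyclicCoord_comp_affineSwap_self {x : ℤ → ℤ} {k : ℤ} (hx : ∀ m, x (m + n) = x m - k)
    (i : ZMod n) :
    cyclicCoord k (x ∘ affineSwap i) i = cyclicCoord k x (i - 1) + k := by
  have := cyclicCoord_intCast hx ((i.val : ℤ) - 1)
  push_cast at this
  rw [ZMod.natCast_zmod_val] at this
  rw [this, cyclicCoord, Function.comp_apply, affineSwap_of_eq (by simp)]
  ring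

theorem cyclicCoord_comp_affineSwap_sub_one {x : ℤ → ℤ} {k : ℤ}
    (hx : ∀ m, x (m + n) = x m - k) (i : ZMod n) :
    cyclicCoord k (x ∘ affineSwap i) (i - 1) = cyclicCoord k x i - k := by
  have := cyclicCoord_intCast hx (((i - 1).val : ℤ) + 1)
  push_cast at this
  rw [ZMod.natCast_zmod_val, sub_add_cancel] at this
  rw [this, cyclicCoord, Function.comp_apply, affineSwap_of_eq_sub_one (by simp)]
  ring

theorem sum_cyclicCoord_comp_affineSwap {x : ℤ → ℤ} {k : ℤ} (hx : ∀ m, x (m + n) = x m - k)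
    (i : ZMod n) :
    ∑ a : ZMod n, cyclicCoord k (x ∘ affineSwap i) a = ∑ a : ZMod n, cyclicCoord k x a := by
  have := Fintype.sum_sub_sum_of_eq_off_pair (p := i - 1) (q := i) (by simp)
    (fun a => cyclicCoord_comp_affineSwap_of_ne (x := x) (k := k) (i := i) (a := a))
  rw [cyclicCoord_comp_affineSwap_self hx, cyclicCoord_comp_affineSwap_sub_one hx] at this
  linarith

/-- With `d` the coordinate at `m + 1` minus that at `m`, the sum of squares changes by `2k(k - d)`.
An ascent makes `d ≥ n + k`. -/
theorem sum_sq_cyclicCoord_comp_affineSwap_lt {x : ℤ → ℤ} {k : ℤ} (hk : 0 < k)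
    (hx : ∀ m, x (m + n) = x m - k) {m : ℤ} (hm : x m < x (m + 1)) :
    ∑ a : ZMod n, cyclicCoord k (x ∘ affineSwap ((m + 1 : ℤ) : ZMod n)) a ^ 2 <
      ∑ a : ZMod n, cyclicCoord k x a ^ 2 := by
  have h1 := cyclicCoord_intCast hx (m + 1)
  have h0 := cyclicCoord_intCast hx m
  set i : ZMod n := ((m + 1 : ℤ) : ZMod n) with hi
  have hi' : (m : ZMod n) = i - 1 := by simp [hi]
  rw [hi'] at h0
  have := Fintype.sum_sub_sum_of_eq_off_pair (p := i - 1) (q := i) (by simp)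
    (fun a h h' => congrArg (· ^ 2)
      (cyclicCoord_comp_affineSwap_of_ne (x := x) (k := k) (i := i) (a := a) h h'))
  simp only [cyclicCoord_comp_affineSwap_self hx, cyclicCoord_comp_affineSwap_sub_one hx] at this
  rw [← sub_neg, this]
  have hn : (0 : ℤ) < n := by exact_mod_cast Nat.pos_of_neZero n
  have hd : k < cyclicCoord k x i - cyclicCoord k x (i - 1) := by
    rw [h0, h1]
    have : (n : ℤ) * 1 ≤ n * (x (m + 1) - x m) :=
      mul_le_mul_of_nonneg_left (by omega) hn.le
    linarith
  have := mul_pos hk (sub_pos.2 hd)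
  linarith

end QuasiPeriodic

/-! ### Chambers as translates of the fundamental lifts -/

namespace CoxeterSystem

variable {n : ℕ} [Fact (1 < n)] {W : Type*} [Group W]
  (cs : CoxeterSystem (affineCoxeterMatrixA n) W)

/-- The lift to `ℤ` of the vertex of label `j` of the chamber `w`. -/
def chamberVertex (w : W) (j : Fin n) (m : ℤ) : ℤ :=
  vertexLift n (j : ℕ) (cs.affinePerm w⁻¹ m)

theorem chamberVertex_apply_affinePerm (w : W) (j : Fin n) (m : ℤ) :
    cs.chamberVertex w j (cs.affinePerm w m) = vertexLift n (j : ℕ) m := by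
  rw [chamberVertex, ← Equiv.Perm.mul_apply, ← map_mul]
  simp

variable [NeZero n]

/-- Bubble sort: swapping at an ascent lowers the sum of squares, a nonnegative integer, so the
process stops at an antitone function. -/
theorem exists_antitone_comp_affinePerm {x : ℤ → ℤ} {k : ℤ} (hk : 0 < k)
    (hx : ∀ m, x (m + n) = x m - k) : ∃ w : W, Antitone (x ∘ cs.affinePerm w) := by
  induction hl : (∑ a : ZMod n, cyclicCoord k x a ^ 2).toNat using Nat.strong_induction_on
    generalizing x with
  | _ l IH =>
  subst hl
  by_cases h : ∀ m, x (m + 1) ≤ x m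
  · exact ⟨1, by simpa using antitone_int_of_succ_le h⟩
  push Not at h
  obtain ⟨m, hm⟩ := h
  have hlt := sum_sq_cyclicCoord_comp_affineSwap_lt hk hx hm
  have hpos : 0 ≤ ∑ a : ZMod n, cyclicCoord k (x ∘ affineSwap ((m + 1 : ℤ) : ZMod n)) a ^ 2 :=
    Finset.sum_nonneg fun _ _ => sq_nonneg _
  obtain ⟨w, hw⟩ := IH _ (by omega)
    (quasiPeriodic_comp_affineSwap hx ((m + 1 : ℤ) : ZMod n)) rfl
  refine ⟨cs.simple ⟨((m + 1 : ℤ) : ZMod n).val, ZMod.val_lt _⟩ * w, ?_⟩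
  rw [map_mul, affinePerm_simple]
  simpa [Function.comp_assoc, Equiv.Perm.coe_mul] using hw

theorem chamberVertex_add (w : W) (j : Fin n) (m : ℤ) :
    cs.chamberVertex w j (m + n) = cs.chamberVertex w j m - 1 := by
  rw [chamberVertex, affinePerm_add, vertexLift_add, chamberVertex]

theorem sum_cyclicCoord_chamberVertex (w : W) (j : Fin n) :
    ∑ a : ZMod n, cyclicCoord 1 (cs.chamberVertex w j) a =
      ∑ a : ZMod n, cyclicCoord 1 (vertexLift n (j : ℕ)) a := by
  induction w using cs.simple_induction_left with
  | one => simp [chamberVertex, cyclicCoord]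
  | mul_simple_left w i ih =>
    rw [← ih, ← sum_cyclicCoord_comp_affineSwap (cs.chamberVertex_add w j) ((i : ℕ) : ZMod n)]
    refine Finset.sum_congr rfl fun a _ => congrArg (fun x => cyclicCoord 1 x a) ?_
    funext m
    rw [Function.comp_apply, chamberVertex, mul_inv_rev, inv_simple, affinePerm_mul_simple_apply,
      chamberVertex]

/-- Adding `c` to the lift of label `j` replaces `j` by `j + c * n`. The invariant sum then forces
`i = j + c * n`, and both labels lie in `[0, n)`. -/
theorem eq_of_chamberVertex_eq_add {w u : W} {i j : Fin n} {c : ℤ}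
    (h : ∀ m, cs.chamberVertex w i m = cs.chamberVertex u j m + c) : i = j ∧ c = 0 := by
  have hn : (0 : ℤ) < n := by exact_mod_cast Nat.pos_of_neZero n
  have hsum : ∑ a : ZMod n, cyclicCoord 1 (vertexLift n (i : ℕ)) a =
      ∑ a : ZMod n, cyclicCoord 1 (vertexLift n ((j : ℕ) + c * n)) a := by
    have e : ∀ (x : ℤ → ℤ) (a : ZMod n), cyclicCoord 1 (fun m => x m + c) a =
        cyclicCoord 1 x a + n * c := fun x a => by rw [cyclicCoord, cyclicCoord]; ring
    rw [← cs.sum_cyclicCoord_chamberVertex w i, funext h,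
      funext (vertexLift_add_mul (n := n) (j : ℕ) · c)]
    simp only [e, Finset.sum_add_distrib, cs.sum_cyclicCoord_chamberVertex u j]
  have hij := sum_cyclicCoord_vertexLift_strictMono.injective hsum
  have hi := i.2
  have hj := j.2
  have hc : c = 0 := by
    by_contra hc
    rcases lt_or_gt_of_ne hc with hc | hc
    · have : c * n ≤ -1 * n := mul_le_mul_of_nonneg_right (by omega) hn.le
      omega
    · have : 1 * (n : ℤ) ≤ c * n := mul_le_mul_of_nonneg_right (by omega) hn.le
      omega
  refine ⟨Fin.ext ?_, hc⟩
  rw [hc] at hij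
  simpa using hij

/-- A vertex is determined by the half-line where its lift is positive, because the other superlevel
sets are its translates by multiples of `n`. -/
theorem chamberVertex_eq_iff (w u : W) (j : Fin n) :
    cs.chamberVertex w j = cs.chamberVertex u j ↔
      ∀ m : ℤ, cs.affinePerm (w⁻¹ * u) m < (j : ℕ) ↔ m < (j : ℕ) := by
  have key : ∀ m, cs.chamberVertex w j (cs.affinePerm u m) =
      vertexLift n (j : ℕ) (cs.affinePerm (w⁻¹ * u) m) := fun m => by
    rw [chamberVertex, map_mul, Equiv.Perm.mul_apply]
  constructor
  · intro h m
    rw [← vertexLift_pos_iff (n := n), ← key, h, chamberVertex_apply_affinePerm,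
      vertexLift_pos_iff]
  · intro h
    funext m
    obtain ⟨m, rfl⟩ := (cs.affinePerm u).surjective m
    rw [key, chamberVertex_apply_affinePerm]
    refine eq_of_forall_lt_iff fun k => ?_
    rw [lt_vertexLift_iff, lt_vertexLift_iff, lt_sub_iff_add_lt, ← affinePerm_add_mul, h,
      lt_sub_iff_add_lt]

theorem forall_chamberVertex_eq_iff (w u : W) (K : Set (Fin n)) :
    (∀ j ∈ K, cs.chamberVertex w j = cs.chamberVertex u j) ↔
      w⁻¹ * u ∈ cs.specialSubgroup Kᶜ := by
  simp only [chamberVertex_eq_iff, mem_specialSubgroup_compl_iff]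

theorem chamberVertex_one_ne_simple (i : Fin n) :
    cs.chamberVertex 1 i ≠ cs.chamberVertex (cs.simple i) i := by
  rw [Ne, chamberVertex_eq_iff]
  intro h
  have := h (i : ℕ)
  rw [inv_one, one_mul, affinePerm_simple, affineSwap_of_eq (by simp)] at this
  omega

end CoxeterSystem

/-! ### The group of the degenerate triangle presentation -/

namespace DegenerateTriangle

variable {n : ℕ}

theorem gen_mul_gen_mul_gen {a b c : ProperSubset n} (h : (a, b, c) ∈ T n) :
    gen a * gen b * gen c = 1 := by
  have : PresentedGroup.mk (relators n) (FreeGroup.of a * FreeGroup.of b * FreeGroup.of c) = 1 :=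
    PresentedGroup.one_of_mem (Or.inl ⟨a, b, c, h, rfl⟩)
  rwa [map_mul, map_mul] at this

theorem gen_mul_gen_compl (a : ProperSubset n) : gen a * gen (compl a) = 1 := by
  have : PresentedGroup.mk (relators n) (FreeGroup.of a * FreeGroup.of (compl a)) = 1 :=
    PresentedGroup.one_of_mem (Or.inr ⟨a, rfl⟩)
  rwa [map_mul] at this

theorem gen_compl (a : ProperSubset n) : gen (compl a) = (gen a)⁻¹ :=
  eq_inv_of_mul_eq_one_right (gen_mul_gen_compl a)

theorem gen_mul_gen_of_disjoint {a b c : ProperSubset n} (h : Disjoint a.1 b.1)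
    (hc : c.1 = a.1 ∪ b.1) : gen a * gen b = gen c := by
  have hT : (a, b, compl c) ∈ T n := by
    refine Or.inl ⟨h, ?_, ?_, ?_⟩
    · exact Disjoint.mono_left (hc ▸ Finset.subset_union_left) disjoint_compl_right
    · exact Disjoint.mono_left (hc ▸ Finset.subset_union_right) disjoint_compl_right
    · change a.1 ∪ b.1 ∪ c.1ᶜ = _
      rw [← hc, Finset.union_compl]
  have := gen_mul_gen_mul_gen hT
  rwa [gen_compl, mul_inv_eq_one] at this

theorem commute_gen_of_disjoint {a b : ProperSubset n} (h : Disjoint a.1 b.1) :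
    Commute (gen a) (gen b) := by
  by_cases hu : a.1 ∪ b.1 = Finset.univ
  · have : b = compl a := Subtype.ext (eq_compl_iff_isCompl.2
      (isCompl_iff.2 ⟨h, codisjoint_iff.2 hu⟩).symm)
    rw [this, gen_compl]
    exact (Commute.refl _).inv_right
  · let c : ProperSubset n := ⟨a.1 ∪ b.1, a.2.1.mono Finset.subset_union_left, hu⟩
    rw [Commute, SemiconjBy, gen_mul_gen_of_disjoint (c := c) h rfl,
      gen_mul_gen_of_disjoint (c := c) h.symm (Finset.union_comm _ _)]

/-- Peel singletons off `a`. A singleton is disjoint from `b` or from its complement, whose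
generator is the inverse of that of `b`. -/
theorem commute_gen (a b : ProperSubset n) : Commute (gen a) (gen b) := by
  obtain ⟨a, ha⟩ := a
  induction a using Finset.induction_on with
  | empty => exact absurd ha.1 (by simp)
  | insert i a hia ih =>
    have hsing : ({i} : Finset (Fin n)) ≠ Finset.univ := by
      intro h
      apply ha.2
      rw [← Finset.univ_subset_iff, ← h]
      simp
    let s : ProperSubset n := ⟨{i}, by simp, hsing⟩
    have hs : Commute (gen s) (gen b) := by
      by_cases hib : i ∈ b.1
      · have : Commute (gen s) (gen (compl b)) :=
          commute_gen_of_disjoint (by simpa [s, compl] using hib)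
        rw [gen_compl] at this
        exact Commute.inv_right_iff.1 this
      · exact commute_gen_of_disjoint (by simpa [s] using hib)
    rcases a.eq_empty_or_nonempty with rfl | hne
    · exact hs
    · have hau : a ≠ Finset.univ := by rintro rfl; exact hia (Finset.mem_univ i)
      rw [← gen_mul_gen_of_disjoint (a := s) (b := ⟨a, hne, hau⟩) (by simpa [s] using hia)
        (Finset.insert_eq i a)]
      exact hs.mul_left (ih ⟨hne, hau⟩)

scoped instance : CommGroup (Gam n) where
  mul_comm u v := by
    have hu : ∀ b : ProperSubset n, ∀ u : Gam n, Commute u (gen b) := fun b u => by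
      have : u ∈ Subgroup.closure (Set.range (PresentedGroup.of (rels := relators n))) := by
        rw [PresentedGroup.closure_range_of]; trivial
      induction this using Subgroup.closure_induction with
      | mem x hx => obtain ⟨a, rfl⟩ := hx; exact commute_gen a b
      | one => exact Commute.one_left _
      | mul x y _ _ hx hy => exact hx.mul_left hy
      | inv x _ hx => exact hx.inv_left
    have : v ∈ Subgroup.closure (Set.range (PresentedGroup.of (rels := relators n))) := by
      rw [PresentedGroup.closure_range_of]; trivial
    change Commute u v
    induction this using Subgroup.closure_induction with
    | mem x hx => obtain ⟨b, rfl⟩ := hx; exact hu b u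
    | one => exact Commute.one_right _
    | mul x y _ _ hx hy => exact hx.mul_right hy
    | inv x _ hx => exact hx.inv_right

/-- The indicator function of a set of coordinates. -/
def indicator (a : Finset (Fin n)) (i : Fin n) : ℤ := if i ∈ a then 1 else 0

theorem indicator_compl (a : Finset (Fin n)) (i : Fin n) :
    indicator aᶜ i = 1 - indicator a i := by
  by_cases h : i ∈ a <;> simp [indicator, h]

theorem indicator_add_of_mem_T₁ {a b c : ProperSubset n} (h : (a, b, c) ∈ T₁ n) (i : Fin n) :
    indicator a.1 i + indicator b.1 i + indicator c.1 i = 1 := by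
  obtain ⟨hab, hac, hbc, hu⟩ := h
  have hi : i ∈ a.1 ∪ b.1 ∪ c.1 := (Finset.ext_iff.1 hu i).2 (Finset.mem_univ i)
  simp only [Finset.mem_union] at hi
  have h1 : i ∈ a.1 → i ∉ b.1 := fun h h' => Finset.disjoint_left.1 hab h h'
  have h2 : i ∈ a.1 → i ∉ c.1 := fun h h' => Finset.disjoint_left.1 hac h h'
  have h3 : i ∈ b.1 → i ∉ c.1 := fun h h' => Finset.disjoint_left.1 hbc h h'
  by_cases ha : i ∈ a.1
  · simp [indicator, ha, h1 ha, h2 ha]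
  · by_cases hb : i ∈ b.1
    · simp [indicator, ha, hb, h3 hb]
    · have hc : i ∈ c.1 := by tauto
      simp [indicator, ha, hb, hc]

/-! ### `Γ_T` as `ℤⁿ` modulo constants -/

section Coordinates

variable [NeZero n]

/-- The coordinates on `Γ_T`, normalized to vanish at `0`. -/
def coord : Gam n →* Multiplicative (Fin n → ℤ) :=
  PresentedGroup.toGroup
    (f := fun a => Multiplicative.ofAdd fun i => indicator a.1 i - indicator a.1 0) <| by
    rintro r (⟨a, b, c, h, rfl⟩ | ⟨a, rfl⟩)
    · simp only [map_mul, FreeGroup.lift_apply_of, ← ofAdd_add]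
      rw [ofAdd_eq_one]
      funext i
      simp only [Pi.add_apply, Pi.zero_apply]
      -- The three indicators sum to the constant `1` on `T₁` and `2` on `T₂`; subtracting the value
      -- at `0` kills constants.
      rcases h with h | h
      · linarith [indicator_add_of_mem_T₁ h i, indicator_add_of_mem_T₁ h 0]
      · have h1 := indicator_add_of_mem_T₁ h i
        have h2 := indicator_add_of_mem_T₁ h 0
        simp only [compl, indicator_compl] at h1 h2
        linarith
    · simp only [map_mul, FreeGroup.lift_apply_of, ← ofAdd_add]
      rw [ofAdd_eq_one]
      funext i
      simp only [Pi.add_apply, Pi.zero_apply, compl, indicator_compl]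
      ring

theorem coord_gen (a : ProperSubset n) (i : Fin n) :
    (coord (gen a)).toAdd i = indicator a.1 i - indicator a.1 0 :=
  congrArg (fun x : Multiplicative (Fin n → ℤ) => x.toAdd i) (PresentedGroup.toGroup.of _)

theorem gen_ne_one (a : ProperSubset n) : gen a ≠ 1 := by
  intro h
  have h1 : ∀ i, indicator a.1 i = indicator a.1 0 := fun i => by
    have := coord_gen a i
    rw [h, map_one] at this
    exact (sub_eq_zero.1 this.symm)
  by_cases h0 : (0 : Fin n) ∈ a.1
  · apply a.2.2
    ext i
    have := h1 i
    simpa [indicator, h0] using this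
  · obtain ⟨i, hi⟩ := a.2.1
    have := h1 i
    simp [indicator, h0, hi] at this

theorem gen_injective : Function.Injective (gen (n := n)) := by
  intro a b h
  have h1 : ∀ i, indicator a.1 i - indicator a.1 0 = indicator b.1 i - indicator b.1 0 :=
      fun i => by
    have := coord_gen a i
    rw [h, coord_gen] at this
    exact this.symm
  have key : ∀ a b : ProperSubset n,
      (∀ i, indicator a.1 i - indicator a.1 0 = indicator b.1 i - indicator b.1 0) →
      (0 : Fin n) ∈ a.1 → (0 : Fin n) ∈ b.1 := by
    -- If `0` lay in `a` but not in `b`, the indicator of `a` would exceed that of `b` by `1`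
    -- everywhere, making `a` the whole set.
    intro a b h ha
    by_contra hb
    apply a.2.2
    ext i
    by_contra hi
    have hi' : i ∉ a.1 := by simpa using hi
    have := h i
    by_cases hib : i ∈ b.1 <;> simp [indicator, ha, hb, hi', hib] at this
  have h0 : (0 : Fin n) ∈ a.1 ↔ (0 : Fin n) ∈ b.1 := ⟨key a b h1, key b a fun i => (h1 i).symm⟩
  have h0' : indicator a.1 0 = indicator b.1 0 := by simp [indicator, h0]
  refine Subtype.ext (Finset.ext fun i => ?_)
  have := h1 i
  rw [h0', sub_left_inj] at this
  by_cases ha : i ∈ a.1 <;> by_cases hb : i ∈ b.1 <;> simp [indicator, ha, hb] at this ⊢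

theorem cayleyGraph_adj_iff (u v : Gam n) :
    (cayleyGraph n).Adj u v ↔ ∃ a : ProperSubset n, v = u * gen a := by
  rw [SimpleGraph.mulCayley_adj']
  constructor
  · rintro ⟨-, _, ⟨a, rfl⟩, h | h⟩
    · exact ⟨a, h.symm⟩
    · exact ⟨compl a, by rw [gen_compl, h, mul_inv_cancel_right]⟩
  · rintro ⟨a, rfl⟩
    exact ⟨fun h => gen_ne_one a (left_eq_mul.1 h), gen a, ⟨a, rfl⟩, Or.inl rfl⟩

end Coordinates

variable [Fact (1 < n)]

theorem singleton_ne_univ (i : Fin n) : ({i} : Finset (Fin n)) ≠ Finset.univ := by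
  intro h
  have := congrArg Finset.card h
  rw [Finset.card_singleton, Finset.card_univ, Fintype.card_fin] at this
  exact absurd this (Fact.out : 1 < n).ne

/-- The generator `g_{{i}}`. -/
def genSingleton (i : Fin n) : Gam n := gen ⟨{i}, Finset.singleton_nonempty i, singleton_ne_univ i⟩

/-- The element of `Γ_T` with given integral coordinates. -/
def ofCoord (x : Fin n → ℤ) : Gam n := ∏ i, genSingleton i ^ x i

theorem ofCoord_add (x y : Fin n → ℤ) : ofCoord (x + y) = ofCoord x * ofCoord y := by
  simp only [ofCoord, Pi.add_apply, zpow_add, Finset.prod_mul_distrib]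

theorem ofCoord_indicator_eq_prod (a : Finset (Fin n)) :
    ofCoord (indicator a) = ∏ i ∈ a, genSingleton i := by
  simp only [ofCoord, indicator, pow_ite, zpow_one, zpow_zero]
  simp

theorem prod_genSingleton (a : ProperSubset n) : ∏ i ∈ a.1, genSingleton i = gen a := by
  obtain ⟨a, ha⟩ := a
  induction a using Finset.induction_on with
  | empty => exact absurd ha.1 (by simp)
  | insert i a hia ih =>
    simp only [] at ih ⊢
    rw [Finset.prod_insert hia]
    rcases a.eq_empty_or_nonempty with rfl | hne
    · simp [genSingleton]
    · have hau : a ≠ Finset.univ := by rintro rfl; exact hia (Finset.mem_univ i)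
      rw [ih ⟨hne, hau⟩]
      exact gen_mul_gen_of_disjoint (by simpa using hia) (Finset.insert_eq i a)

theorem ofCoord_indicator (a : ProperSubset n) : ofCoord (indicator a.1) = gen a := by
  rw [ofCoord_indicator_eq_prod, prod_genSingleton]

/-- `ofCoord` as a homomorphism. -/
def ofCoordHom : Multiplicative (Fin n → ℤ) →* Gam n :=
  AddMonoidHom.toMultiplicativeLeft
    { toFun := fun x => Additive.ofMul (ofCoord x)
      map_zero' := by simp [ofCoord]
      map_add' := fun x y => congrArg Additive.ofMul (ofCoord_add x y) }

theorem ofCoord_surjective : Function.Surjective (ofCoord (n := n)) := by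
  intro u
  have : u ∈ (ofCoordHom (n := n)).range := by
    refine PresentedGroup.generated_by _ _ (fun a => ?_) u
    exact ⟨Multiplicative.ofAdd (indicator a.1), ofCoord_indicator a⟩
  obtain ⟨x, hx⟩ := this
  exact ⟨x.toAdd, hx⟩

/-- The element of `Γ_T` given by the restriction of a function on `ℤ` to `0, …, n - 1`. -/
def ofLift (x : ℤ → ℤ) : Gam n := ofCoord fun i : Fin n => x (i : ℕ)

variable [NeZero n]

theorem ofCoord_one : ofCoord (1 : Fin n → ℤ) = 1 := by
  let a : ProperSubset n := ⟨{0}, Finset.singleton_nonempty 0, singleton_ne_univ 0⟩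
  rw [← gen_mul_gen_compl a, ← ofCoord_indicator, ← ofCoord_indicator, ← ofCoord_add]
  congr 1
  funext i
  simp [compl, indicator_compl]

theorem ofCoord_const (c : ℤ) : ofCoord (fun _ : Fin n => c) = 1 := by
  have : ofCoord (c • (1 : Fin n → ℤ)) = ofCoord 1 ^ c :=
    map_zpow ofCoordHom (Multiplicative.ofAdd (1 : Fin n → ℤ)) c
  rw [ofCoord_one, one_zpow] at this
  rw [← this]
  congr 1
  funext i
  simp

theorem coord_ofCoord (x : Fin n → ℤ) (i : Fin n) :
    (coord (ofCoord x)).toAdd i = x i - x 0 := by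
  simp only [ofCoord, map_prod, map_zpow, toAdd_prod, toAdd_zpow, Finset.sum_apply, Pi.smul_apply,
    genSingleton, coord_gen, smul_eq_mul, mul_sub, Finset.sum_sub_distrib]
  simp [indicator]

theorem ofCoord_eq_iff (x y : Fin n → ℤ) :
    ofCoord x = ofCoord y ↔ ∃ c, ∀ i, x i = y i + c := by
  constructor
  · intro h
    refine ⟨x 0 - y 0, fun i => ?_⟩
    have := coord_ofCoord x i
    rw [h, coord_ofCoord] at this
    linarith
  · rintro ⟨c, hc⟩
    rw [show x = y + fun _ => c from funext hc, ofCoord_add, ofCoord_const, mul_one]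

end DegenerateTriangle

/-! ### Adjacency and cliques in terms of lifts -/

namespace DegenerateTriangle

variable {n : ℕ} [NeZero n]

theorem exists_fin_add_mul (m : ℤ) : ∃ (i : Fin n) (l : ℤ), m = (i : ℕ) + l * n := by
  have hn : (0 : ℤ) < n := by exact_mod_cast Nat.pos_of_neZero n
  have h0 := Int.emod_nonneg m hn.ne'
  have h1 := Int.emod_lt_of_pos m hn
  refine ⟨⟨(m % n).toNat, by omega⟩, m / n, ?_⟩
  rw [Int.toNat_of_nonneg h0, Int.emod_add_ediv_mul]

/-- The extension of a function on `0, …, n - 1` to `ℤ` with `x (m + n) = x m - 1`. -/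
def extend (x : Fin n → ℤ) (m : ℤ) : ℤ := x (Fin.ofNat n (m % n).toNat) - m / n

theorem extend_add (x : Fin n → ℤ) (m : ℤ) : extend x (m + n) = extend x m - 1 := by
  have hn : (n : ℤ) ≠ 0 := by exact_mod_cast NeZero.ne n
  rw [extend, extend, Int.add_emod_right, Int.add_ediv_of_dvd_right dvd_rfl, Int.ediv_self hn]
  ring

theorem extend_coe (x : Fin n → ℤ) (i : Fin n) : extend x (i : ℕ) = x i := by
  have hi : ((i : ℕ) : ℤ) < n := by exact_mod_cast i.2
  rw [extend, Int.emod_eq_of_lt (by omega) hi, Int.ediv_eq_zero_of_lt (by omega) hi, sub_zero]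
  congr 1
  ext
  simp

theorem quasiPeriodic_le {x y : ℤ → ℤ} {c : ℤ} (hx : ∀ m, x (m + n) = x m - 1)
    (hy : ∀ m, y (m + n) = y m - 1) (h : ∀ i : Fin n, x (i : ℕ) ≤ y (i : ℕ) + c) (m : ℤ) :
    x m ≤ y m + c := by
  obtain ⟨i, l, rfl⟩ := exists_fin_add_mul (n := n) m
  rw [quasiPeriodic_mul hx, quasiPeriodic_mul hy]
  linarith [h i]

variable [Fact (1 < n)]

theorem ofLift_eq_iff {x y : ℤ → ℤ} (hx : ∀ m, x (m + n) = x m - 1)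
    (hy : ∀ m, y (m + n) = y m - 1) :
    ofLift (n := n) x = ofLift y ↔ ∃ c, ∀ m, x m = y m + c := by
  rw [ofLift, ofLift, ofCoord_eq_iff]
  refine exists_congr fun c => ⟨fun h m => ?_, fun h i => h _⟩
  obtain ⟨i, l, rfl⟩ := exists_fin_add_mul (n := n) m
  rw [quasiPeriodic_mul hx, quasiPeriodic_mul hy, h]
  ring

/-- Distinct elements of `Γ_T` with lifts in a common unit interval are adjacent. -/
theorem adj_of_le_of_le {x y : ℤ → ℤ} (hle : ∀ m, x m ≤ y m) (hle' : ∀ m, y m ≤ x m + 1)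
    (hne : ofLift (n := n) x ≠ ofLift y) : (cayleyGraph n).Adj (ofLift x) (ofLift y) := by
  rw [cayleyGraph_adj_iff]
  let a : Finset (Fin n) := Finset.univ.filter fun i => y (i : ℕ) = x (i : ℕ) + 1
  have ha : ∀ i : Fin n, y (i : ℕ) = x (i : ℕ) + indicator a i := by
    intro i
    have h1 := hle (i : ℕ)
    have h2 := hle' (i : ℕ)
    by_cases h : y (i : ℕ) = x (i : ℕ) + 1
    · simp [indicator, a, h]
    · simp only [indicator, a, Finset.mem_filter, Finset.mem_univ, true_and, if_neg h]
      omega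
  have hconst : ∀ c, (∀ i, indicator a i = c) → False := fun c hc =>
    hne ((ofCoord_eq_iff _ _).2 ⟨-c, fun i => by rw [ha, hc]; ring⟩)
  have hnonempty : a.Nonempty := by
    rw [Finset.nonempty_iff_ne_empty]
    intro h
    exact hconst 0 fun i => by simp [indicator, h]
  have huniv : a ≠ Finset.univ := by
    intro h
    exact hconst 1 fun i => by simp [indicator, h]
  refine ⟨⟨a, hnonempty, huniv⟩, ?_⟩
  rw [← ofCoord_indicator, ofLift, ofLift, ← ofCoord_add]
  exact congrArg ofCoord (funext ha)

theorem exists_lift_of_adj {y : ℤ → ℤ} (hy : ∀ m, y (m + n) = y m - 1) {v : Gam n}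
    (h : (cayleyGraph n).Adj (ofLift y) v) : ∃ z : ℤ → ℤ, (∀ m, z (m + n) = z m - 1) ∧
      (∀ m, y m ≤ z m) ∧ (∀ m, z m ≤ y m + 1) ∧ ofLift z = v := by
  obtain ⟨a, rfl⟩ := (cayleyGraph_adj_iff _ _).1 h
  have hind : ∀ i, 0 ≤ indicator a.1 i ∧ indicator a.1 i ≤ 1 := fun i => by
    unfold indicator; split_ifs <;> simp
  have hz := extend_add fun i : Fin n => y (i : ℕ) + indicator a.1 i
  refine ⟨extend fun i => y (i : ℕ) + indicator a.1 i, hz, fun m => ?_, ?_, ?_⟩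
  · simpa using quasiPeriodic_le (c := 0) hy hz
      (fun i => by rw [extend_coe]; linarith [hind i]) m
  · exact quasiPeriodic_le hz hy (fun i => by rw [extend_coe]; linarith [hind i])
  · rw [← ofCoord_indicator, ofLift, ofLift, ← ofCoord_add]
    simp only [extend_coe]
    rfl

/-- Adjacency means `y = x + indicator a + c` on `0, …, n - 1`. A point in `a` gives `c ≤ 0` and a
point outside gives `c ≥ -1`; the two values of `c` give the two comparisons. -/
theorem le_or_le_of_adj {x y z : ℤ → ℤ} (hx : ∀ m, x (m + n) = x m - 1)
    (hy : ∀ m, y (m + n) = y m - 1) (hxz : ∀ m, z m ≤ x m) (hxz' : ∀ m, x m ≤ z m + 1)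
    (hyz : ∀ m, z m ≤ y m) (hyz' : ∀ m, y m ≤ z m + 1)
    (h : (cayleyGraph n).Adj (ofLift x) (ofLift y)) : x ≤ y ∨ y ≤ x := by
  obtain ⟨a, ha⟩ := (cayleyGraph_adj_iff _ _).1 h
  rw [← ofCoord_indicator, ofLift, ofLift, ← ofCoord_add, ofCoord_eq_iff] at ha
  obtain ⟨c, hc⟩ := ha
  simp only [Pi.add_apply] at hc
  obtain ⟨i, hi⟩ := a.2.1
  obtain ⟨j, hj⟩ : ∃ j, j ∉ a.1 := by
    by_contra! hall
    exact a.2.2 (Finset.eq_univ_iff_forall.2 hall)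
  have hci := hc i
  have hcj := hc j
  simp only [indicator, hi, hj, if_true, if_false] at hci hcj
  have h1 := hxz (i : ℕ)
  have h2 := hyz' (i : ℕ)
  have h3 := hxz' (j : ℕ)
  have h4 := hyz (j : ℕ)
  have hind : ∀ i, 0 ≤ indicator a.1 i ∧ indicator a.1 i ≤ 1 := fun i => by
    unfold indicator; split_ifs <;> simp
  rcases (by omega : c = 0 ∨ c = -1) with rfl | rfl
  · left
    intro m
    simpa using quasiPeriodic_le (c := 0) hx hy (fun i => by linarith [hc i, hind i]) m
  · right
    intro m
    simpa using quasiPeriodic_le (c := 0) hy hx (fun i => by linarith [hc i, hind i]) m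

variable {W : Type*} [Group W] (cs : CoxeterSystem (affineCoxeterMatrixA n) W)

/-- The vertex of label `j` of the chamber `w`, as an element of `Γ_T`. -/
def chamber (w : W) (j : Fin n) : Gam n := ofLift (cs.chamberVertex w j)

theorem chamber_eq_iff {w u : W} {i j : Fin n} :
    chamber cs w i = chamber cs u j ↔ i = j ∧ cs.chamberVertex w i = cs.chamberVertex u j := by
  rw [chamber, chamber, ofLift_eq_iff (cs.chamberVertex_add w i) (cs.chamberVertex_add u j)]
  constructor
  · rintro ⟨c, hc⟩
    obtain ⟨rfl, rfl⟩ := cs.eq_of_chamberVertex_eq_add hc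
    exact ⟨rfl, funext fun m => by rw [hc, add_zero]⟩
  · rintro ⟨-, h⟩
    exact ⟨0, fun m => by rw [h, add_zero]⟩

theorem adj_chamber_of_lt (w : W) {i j : Fin n} (h : i < j) :
    (cayleyGraph n).Adj (chamber cs w i) (chamber cs w j) := by
  have hij : (i : ℕ) < j := h
  have hj := j.2
  refine adj_of_le_of_le (fun m => vertexLift_mono (by omega) _)
    (fun m => vertexLift_le_add_one (by omega) _) fun he => h.ne ?_
  exact ((chamber_eq_iff cs).1 he).1

theorem isClique_iff_subset_range_chamber (s : Finset (Gam n)) :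
    (cayleyGraph n).IsClique (s : Set (Gam n)) ↔
      ∃ w : W, (s : Set (Gam n)) ⊆ Set.range (chamber cs w) := by
  constructor
  · intro hs
    rcases s.eq_empty_or_nonempty with rfl | ⟨v₀, hv₀⟩
    · exact ⟨1, by simp⟩
    obtain ⟨y, hy, hyv⟩ : ∃ y : ℤ → ℤ, (∀ m, y (m + n) = y m - 1) ∧ ofLift y = v₀ := by
      obtain ⟨x, hx⟩ := ofCoord_surjective v₀
      refine ⟨extend x, extend_add x, ?_⟩
      rw [ofLift]
      simpa only [extend_coe] using hx
    -- All lifts are chosen relative to one base vertex `v₀`. Outside `s` the value `y` is a mere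
    -- default.
    have hex : ∀ v : Gam n, ∃ z : ℤ → ℤ, v ∈ s → (∀ m, z (m + n) = z m - 1) ∧
        (∀ m, y m ≤ z m) ∧ (∀ m, z m ≤ y m + 1) ∧ ofLift z = v := by
      intro v
      by_cases hv : v = v₀
      · exact ⟨y, fun _ => ⟨hy, fun _ => le_rfl, fun _ => by omega, hyv.trans hv.symm⟩⟩
      by_cases hvs : v ∈ s
      · obtain ⟨z, hz⟩ := exists_lift_of_adj hy (hyv ▸ hs hv₀ hvs (Ne.symm hv))
        exact ⟨z, fun _ => hz⟩
      · exact ⟨y, fun h => absurd h hvs⟩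
    choose z hz using hex
    have hsum : ∀ m, ∑ v ∈ s, z v (m + n) = ∑ v ∈ s, z v m - (s.card : ℤ) := fun m => by
      rw [Finset.sum_congr rfl fun v hv => (hz v hv).1 m, Finset.sum_sub_distrib]
      simp
    -- A single `w` must sort all lifts at once, so the sorting is applied to their sum, which drops
    -- by `s.card` over a period.
    obtain ⟨w, hw⟩ := cs.exists_antitone_comp_affinePerm
      (x := fun m => ∑ v ∈ s, z v m) (k := s.card)
      (by exact_mod_cast Finset.card_pos.2 ⟨v₀, hv₀⟩) hsum
    have hanti := antitone_of_antitone_sum (s := s) (x := fun v m => z v (cs.affinePerm w m))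
      (y := fun m => y (cs.affinePerm w m)) (fun v hv m => (hz v hv).2.1 _)
      (fun v hv m => (hz v hv).2.2.1 _) (fun u hu v hv => by
        by_cases huv : u = v
        · exact Or.inl (huv ▸ le_rfl)
        obtain ⟨hu1, hu2, hu3, hu4⟩ := hz u hu
        obtain ⟨hv1, hv2, hv3, hv4⟩ := hz v hv
        exact (le_or_le_of_adj hu1 hv1 hu2 hu3 hv2 hv3 (by rw [hu4, hv4]; exact hs hu hv huv)).imp
          (fun h m => h _) (fun h m => h _)) hw
    refine ⟨w, fun v hv => ?_⟩
    obtain ⟨hv1, -, -, hv4⟩ := hz v hv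
    obtain ⟨j, c, hc⟩ := exists_eq_vertexLift_add_of_antitone (n := n)
      (fun m => by rw [cs.affinePerm_add, hv1]) (hanti v hv)
    refine ⟨j, ?_⟩
    rw [← hv4, chamber, ofLift_eq_iff (cs.chamberVertex_add w j) hv1]
    refine ⟨-c, fun m => ?_⟩
    obtain ⟨m, rfl⟩ := (cs.affinePerm w).surjective m
    rw [hc, cs.chamberVertex_apply_affinePerm]
    ring
  · rintro ⟨w, hw⟩ u hu v hv huv
    obtain ⟨i, rfl⟩ := hw hu
    obtain ⟨j, rfl⟩ := hw hv
    rcases lt_trichotomy i j with h | rfl | h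
    · exact adj_chamber_of_lt cs w h
    · exact absurd rfl huv
    · exact (adj_chamber_of_lt cs w h).symm

end DegenerateTriangle

theorem mainTheorem9 (n : ℕ) (hn : 2 ≤ n) {W : Type*} [Group W]
    (cs : CoxeterSystem (affineCoxeterMatrixA n) W) :
    -- the generators are pairwise distinct and nontrivial: the Cayley graph is a simple graph
    (Function.Injective (DegenerateTriangle.gen (n := n)) ∧
      ∀ a : DegenerateTriangle.ProperSubset n, DegenerateTriangle.gen a ≠ 1) ∧
    -- the flag complex of the Cayley graph is isomorphic to the Coxeter complex
    Nonempty (FlagComplex (DegenerateTriangle.cayleyGraph n) ≃o cs.CoxeterComplex) ∧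
    -- the Cayley graph is isomorphic to the 1-skeleton of the Coxeter complex
    Nonempty (DegenerateTriangle.cayleyGraph n ≃g oneSkeleton cs.CoxeterComplex) := by
  have : NeZero n := ⟨by omega⟩
  have : Fact (1 < n) := ⟨by omega⟩
  have hiso := cs.flagComplex_orderIso (DegenerateTriangle.cayleyGraph n)
    (DegenerateTriangle.chamber cs)
    (fun w u i j h => ((DegenerateTriangle.chamber_eq_iff cs).1 h).1)
    (fun w u K => by
      simp only [DegenerateTriangle.chamber_eq_iff, true_and]
      exact cs.forall_chamberVertex_eq_iff w u K)
    (fun i h => cs.chamberVertex_one_ne_simple i ((DegenerateTriangle.chamber_eq_iff cs).1 h).2)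
    (DegenerateTriangle.isClique_iff_subset_range_chamber cs)
  exact ⟨⟨DegenerateTriangle.gen_injective, DegenerateTriangle.gen_ne_one⟩, hiso,
    hiso.elim fun e => oneSkeleton_of_flagComplex_orderIso _ e⟩
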